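/- Let $k$ be a perfect field of characteristic $p>0$, let $\sigma\subseteq\mathbb R^d$ be a rational polyhedral cone (generated by finitely many vectors of $\mathbb Z^d$), and let $R=k[\sigma^\vee\cap\mathbb Z^d]$ be the associated (normal) affine toric ring, where $\sigma^\vee\cap\mathbb Z^d=\{u\in\mathbb Z^d:\langle u,v\rangle\ge 0\text{ for all }v\in\sigma\}$. For a commutative $k$-algebra $A$, $e\ge 0$ and $q=p^e$, let $A^{1/q}$ be the ring of formal $q$-th roots $x^{1/q}$ of elements $x\in A$ (a copy of the ring $A$), regarded as an $A$-module by $r\cdot x^{1/q}=(r^qx)^{1/q}$. The full Cartier algebra of $R$ is the graded ring $\mathcal C_R=\bigoplus_{e\ge0}\operatorname{Hom}_R(R^{1/p^e},R)$ with product $\varphi\cdot\psi=\varphi\circ\psi^{1/p^{a}}$ for $\varphi$ of degree $a$, where $f^{1/q}(x^{1/q})=f(x)^{1/q}$ for any map $f$. For $n\ge1$ let $\Delta_n:R^{\otimes n}\to R$ be the multiplication map (tensor products over $k$), and let $\mathcal D^{(n)}_e(R)\subseteq\operatorname{Hom}_R(R^{1/q},R)$ be the set of those $\varphi$ for which there is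 an $R^{\otimes n}$-linear map $\widehat\varphi:(R^{\otimes n})^{1/q}\to R^{\otimes n}$ with $\Delta_n\circ\widehat\varphi=\varphi\circ\Delta_n^{1/q}$. The $n$-th diagonal Cartier algebra of $R$ is the graded subring $\mathcal D^{(n)}(R)=\bigoplus_{e\ge0}\mathcal D^{(n)}_e(R)$ of $\mathcal C_R$. The ring $R$ is called $n$-diagonally $F$-regular if for every nonzero $x\in R$ there are $e\ge0$ and $\varphi\in\mathcal D^{(n)}_e(R)$ with $\varphi(x^{1/p^e})=1$. Then $\mathcal D^{(n)}(R)\supseteq\mathcal D^{(n+1)}(R)$ for all $n>0$. In particular, if $R$ is $n$-diagonally $F$-regular, then it is $m$-diagonally $F$-regular for all $1\le m\le n$. -/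

import Mathlib

open scoped DirectSum TensorProduct

noncomputable section

namespace DiagCartier

/-! ### Roots of a ring of characteristic `p` -/

section Roots

variable (k : Type*) [Field k] (p : ℕ) [Fact p.Prime] [CharP k p]

theorem add_pow_q {A : Type*} [CommRing A] [Algebra k A] (e : ℕ) (x y : A) :
    (x + y) ^ p ^ e = x ^ p ^ e + y ^ p ^ e := by
  rcases subsingleton_or_nontrivial A with h | h
  · exact Subsingleton.elim _ _
  · have : CharP A p := charP_of_injective_algebraMap (algebraMap k A).injective p
    exact add_pow_char_pow x y p e

/-- The `e`-th iterate of Frobenius, `x ↦ x ^ q` with `q = p ^ e`, on a commutative algebra over a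
field of characteristic `p`. -/
def frobPow (e : ℕ) (A : Type*) [CommRing A] [Algebra k A] : A →+* A where
  toFun x := x ^ p ^ e
  map_one' := one_pow _
  map_mul' x y := mul_pow x y _
  map_zero' := zero_pow (pow_ne_zero _ (Fact.out : p.Prime).ne_zero)
  map_add' := add_pow_q k p e

/-- The ring `A^{1/q}` of `q`-th roots of elements of `A`, where `q = p ^ e`. Its elements are the
formal roots `root x = x^{1/q}`, one for each `x : A`; as a ring it is a copy of `A`, and `A` acts
by `r • x^{1/q} = (r ^ q * x)^{1/q}`, so that `(x^{1/q}) ^ q = x`. -/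
def FrobRoot (_k : Type*) (_p _e : ℕ) (A : Type*) : Type _ := A

variable (e : ℕ) {A : Type*} [CommRing A] [Algebra k A]

instance : CommRing (FrobRoot k p e A) := inferInstanceAs (CommRing A)

instance : Algebra A (FrobRoot k p e A) := RingHom.toAlgebra (frobPow k p e A)

/-- The bijection `x ↦ x^{1/q}` from `A` to `A^{1/q}`. -/
def root : A ≃+* FrobRoot k p e A := RingEquiv.refl A

theorem smul_root (r x : A) : r • root k p e x = root k p e (r ^ p ^ e * x) := rfl

theorem root_pow_q (x : A) :
    (root k p e x) ^ p ^ e = algebraMap A (FrobRoot k p e A) x := rfl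

/-- The functor `(·)^{1/q}` on ring homomorphisms: `f^{1/q} (x^{1/q}) = (f x)^{1/q}`. -/
def rootMap {B : Type*} [CommRing B] [Algebra k B] (f : A →+* B) :
    FrobRoot k p e A →+* FrobRoot k p e B :=
  ((root k p e : B ≃+* FrobRoot k p e B) : B →+* FrobRoot k p e B).comp
    (f.comp ((root k p e : A ≃+* FrobRoot k p e A).symm : FrobRoot k p e A →+* A))

end Roots

/-! ### The full Cartier algebra -/

section Cartier

variable (k : Type*) [Field k] (p : ℕ) [Fact p.Prime] [CharP k p]
variable (R : Type*) [CommRing R] [Algebra k R]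

/-- The `p^{-e}`-linear maps on `R`, i.e. `Hom_R(R^{1/q}, R)` with `q = p ^ e`. -/
abbrev CartierMap (e : ℕ) : Type _ := FrobRoot k p e R →ₗ[R] R

variable {k p R}

/-- Elements of degrees `d` and `e` multiply by `φ · ψ = φ ∘ ψ^{1/p^d}`. -/
def CartierMap.mul {d e : ℕ} (φ : CartierMap k p R d) (ψ : CartierMap k p R e) :
    CartierMap k p R (d + e) where
  toFun x := φ (root k p d (ψ (root k p e ((root k p (d + e)).symm x))))
  map_add' x y := by simp
  map_smul' r x := by
    obtain ⟨y, rfl⟩ := (root k p (d + e)).surjective x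
    have h : r ^ p ^ (d + e) * y = (r ^ p ^ d) ^ p ^ e * y := by rw [pow_add, pow_mul]
    simp only [smul_root, RingEquiv.symm_apply_apply, RingHom.id_apply]
    rw [h, ← smul_root, map_smul, smul_eq_mul, ← smul_root, map_smul]

@[simp]
theorem CartierMap.mul_root {d e : ℕ} (φ : CartierMap k p R d) (ψ : CartierMap k p R e) (y : R) :
    φ.mul ψ (root k p (d + e) y) = φ (root k p d (ψ (root k p e y))) := rfl

variable (k p R) in
/-- The identity of `R`, in degree `0`. -/
def CartierMap.one : CartierMap k p R 0 where
  toFun x := (root k p 0).symm x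
  map_add' x y := map_add _ x y
  map_smul' r x := by
    obtain ⟨y, rfl⟩ := (root k p 0).surjective x
    simp [smul_root]

@[simp]
theorem CartierMap.one_root (y : R) : CartierMap.one k p R (root k p 0 y) = y := rfl

theorem CartierMap.sigma_ext {i j : ℕ} (h : i = j) (φ : CartierMap k p R i)
    (ψ : CartierMap k p R j) (H : ∀ y : R, φ (root k p i y) = ψ (root k p j y)) :
    (GradedMonoid.mk i φ : GradedMonoid (CartierMap k p R)) = GradedMonoid.mk j ψ := by
  subst h
  congr 1
  ext x
  obtain ⟨y, rfl⟩ := (root k p i).surjective x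
  exact H y

instance : GradedMonoid.GMul (CartierMap k p R) where
  mul φ ψ := φ.mul ψ

instance : GradedMonoid.GOne (CartierMap k p R) where
  one := CartierMap.one k p R

instance : GradedMonoid.GMonoid (CartierMap k p R) where
  one_mul a := CartierMap.sigma_ext (zero_add _) _ _ fun _ => rfl
  mul_one a := CartierMap.sigma_ext (add_zero _) _ _ fun _ => rfl
  mul_assoc a b c := CartierMap.sigma_ext (add_assoc _ _ _) _ _ fun _ => rfl

instance : DirectSum.GSemiring (CartierMap k p R) where
  mul_zero φ := by
    ext x
    exact map_zero φ
  zero_mul ψ := by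
    ext x
    rfl
  mul_add φ ψ χ := by
    ext x
    exact map_add φ (root k p _ _) (root k p _ _)
  add_mul φ ψ χ := by
    ext x
    rfl
  natCast n := n • CartierMap.one k p R
  natCast_zero := zero_smul _ _
  natCast_succ n := succ_nsmul _ n

instance : DirectSum.GRing (CartierMap k p R) where
  intCast n := n • CartierMap.one k p R
  intCast_ofNat n := natCast_zsmul _ n
  intCast_negSucc_ofNat n := negSucc_zsmul _ n

variable (k p R) in
/-- The full Cartier algebra `⨁ e, Hom_R(R^{1/p^e}, R)` of `R`, a graded (noncommutative) ring. -/
abbrev FullCartierAlgebra : Type _ := ⨁ e, CartierMap k p R e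

end Cartier

/-! ### The diagonal Cartier algebras -/

section Diagonal

variable (k : Type*) [Field k] (p : ℕ) [Fact p.Prime] [CharP k p]
variable (R : Type*) [CommRing R] [Algebra k R]

/-- The `n`-fold tensor power of `R` over `k`. -/
abbrev TensorPow (n : ℕ) : Type _ := ⨂[k] (_ : Fin n), R

/-- The multiplication map `Δ_n : R^{⊗n} → R`, `x_1 ⊗ ⋯ ⊗ x_n ↦ x_1 ⋯ x_n`. -/
def diagMap (n : ℕ) : TensorPow k R n →ₐ[k] R :=
  PiTensorProduct.liftAlgHom (MultilinearMap.mkPiAlgebra k (Fin n) R) (by simp)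
    (fun x y => by simp [Finset.prod_mul_distrib])

theorem diagMap_tprod (n : ℕ) (x : Fin n → R) :
    diagMap k R n (PiTensorProduct.tprod k x) = ∏ i, x i := by
  simp [diagMap, PiTensorProduct.liftAlgHom]

variable {R} in
/-- `φ` admits a `p^{-e}`-linear lifting to `R^{⊗n}` compatible with the diagonal. -/
def LiftsToTensorPow (n : ℕ) {e : ℕ} (φ : CartierMap k p R e) : Prop :=
  ∃ φ' : CartierMap k p (TensorPow k R n) e, ∀ z : FrobRoot k p e (TensorPow k R n),
    φ (rootMap k p e (diagMap k R n : TensorPow k R n →+* R) z) = diagMap k R n (φ' z)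

/-- The degree-`e` part of the `n`-th diagonal Cartier algebra of `R` over `k`. -/
def diagonalDegree (n e : ℕ) : AddSubgroup (CartierMap k p R e) where
  carrier := {φ | LiftsToTensorPow k p n φ}
  zero_mem' := ⟨0, fun z => by simp⟩
  add_mem' := by
    rintro φ ψ ⟨φ', h⟩ ⟨ψ', h'⟩
    exact ⟨φ' + ψ', fun z => by simp [h, h']⟩
  neg_mem' := by
    rintro φ ⟨φ', h⟩
    exact ⟨-φ', fun z => by simp [h]⟩

variable {R} in
theorem one_mem_diagonalDegree (n : ℕ) : CartierMap.one k p R ∈ diagonalDegree k p R n 0 :=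
  ⟨CartierMap.one k p _, fun _ => rfl⟩

variable {R} in
theorem mul_mem_diagonalDegree (n : ℕ) {d e : ℕ} {φ : CartierMap k p R d} {ψ : CartierMap k p R e}
    (hφ : φ ∈ diagonalDegree k p R n d) (hψ : ψ ∈ diagonalDegree k p R n e) :
    φ.mul ψ ∈ diagonalDegree k p R n (d + e) := by
  obtain ⟨φ', h⟩ := hφ
  obtain ⟨ψ', h'⟩ := hψ
  refine ⟨φ'.mul ψ', fun z => ?_⟩
  obtain ⟨y, rfl⟩ := (root k p (d + e)).surjective z
  rw [CartierMap.mul_root, ← h]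
  exact congrArg (fun t => φ (root k p d t)) (h' (root k p e y))

/-- The `n`-th diagonal Cartier algebra `D^{(n)}(R)` of `R` over `k`: the graded subring of the full
Cartier algebra consisting of the elements all of whose homogeneous components lift to `R^{⊗n}`
compatibly with the diagonal. -/
def diagonalCartierAlgebra (n : ℕ) : Subring (FullCartierAlgebra k p R) where
  carrier := {x | ∀ e, x e ∈ diagonalDegree k p R n e}
  zero_mem' _ := zero_mem _
  add_mem' hx hy e := add_mem (hx e) (hy e)
  neg_mem' hx e := neg_mem (hx e)
  one_mem' e := by
    by_cases h : e = 0
    · subst h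
      exact one_mem_diagonalDegree k p n
    · have : (1 : FullCartierAlgebra k p R) e = 0 := DirectSum.of_eq_of_ne _ _ _ h
      rw [this]
      exact zero_mem _
  mul_mem' := by
    classical
    intro x y hx hy e
    rw [DirectSum.mul_eq_sum_support_ghas_mul, DFinsupp.finsetSum_apply]
    refine sum_mem fun ij _ => ?_
    by_cases h : e = ij.1 + ij.2
    · subst h
      rw [DirectSum.of_eq_same]
      exact mul_mem_diagonalDegree k p n (hx _) (hy _)
    · rw [DirectSum.of_eq_of_ne _ _ _ h]
      exact zero_mem _

/-- `R` is `n`-diagonally `F`-regular over `k`: every nonzero `x : R` satisfies `φ (x^{1/p^e}) = 1`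
for some `e` and some `φ ∈ D^{(n)}_e(R)`. -/
def IsDiagonallyFRegular (n : ℕ) : Prop :=
  ∀ x : R, x ≠ 0 → ∃ e : ℕ, ∃ φ ∈ diagonalDegree k p R n e, φ (root k p e x) = 1

end Diagonal

/-! ### Affine toric rings -/

section Toric

variable {d : ℕ}

/-- A rational polyhedral cone in `ℝ^d`: one generated by finitely many vectors of `ℤ^d`. -/
def IsRationalCone (σ : PointedCone ℝ (Fin d → ℝ)) : Prop :=
  ∃ s : Finset (Fin d → ℤ), σ = PointedCone.hull ℝ ((fun v i => (v i : ℝ)) '' (s : Set (Fin d → ℤ)))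

/-- The lattice points of the dual cone: the `u ∈ ℤ^d` with `⟨u, v⟩ ≥ 0` for all `v ∈ σ`. -/
def dualMonoid (σ : PointedCone ℝ (Fin d → ℝ)) : AddSubmonoid (Fin d → ℤ) where
  carrier := {u | ∀ v ∈ σ, 0 ≤ ∑ i, (u i : ℝ) * v i}
  zero_mem' v _ := by simp
  add_mem' {a b} ha hb v hv := by
    have := add_nonneg (ha v hv) (hb v hv)
    simpa [add_mul, Finset.sum_add_distrib] using this

/-- The affine toric ring `R(σ) = k[σ^∨ ∩ ℤ^d]` of the cone `σ` over `k`. -/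
abbrev ToricRing (k : Type*) [Field k] (σ : PointedCone ℝ (Fin d → ℝ)) : Type _ :=
  AddMonoidAlgebra k (dualMonoid σ)

end Toric

end DiagCartier

end

/-!
The argument is formal, for a commutative algebra `R` over a field `k` of characteristic `p`.

The tensor power `R^{⊗n}` is the `n`-fold coproduct of `R` in commutative `k`-algebras, so a map of
indices `f : Fin m → Fin n` induces an algebra homomorphism `f_* : R^{⊗m} → R^{⊗n}`
(`tensorPowMap`), functorially in `f`, and `Δ_n ∘ f_* = Δ_m` (`diagMap_comp_tensorPowMap`). When
`1 ≤ m ≤ n`, the inclusion `f : Fin m → Fin n` has a left inverse `g`, so `ι = f_*` is a section of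
`μ = g_*`; for `n = m + 1`, one may think of `ι z = z ⊗ 1` and of `μ` as multiplying two of the
factors together. If `φ'` lifts `φ` to `R^{⊗n}`, then `μ ∘ φ' ∘ ι^{1/q}` is
`R^{⊗m}`-linear because `μ ∘ ι = id`, and it lifts `φ` because `ι` and `μ` commute with the
diagonal maps (`diagonalDegree_le`). Both assertions follow from this.
-/

noncomputable section

namespace DiagCartier

/-! ### Functoriality of tensor powers in the index set -/

section TensorPow

variable (k : Type*) [Field k] (R : Type*) [CommRing R] [Algebra k R]

/-- The inclusion `a ↦ 1 ⊗ ⋯ ⊗ a ⊗ ⋯ ⊗ 1` of the `i`-th factor into `R^{⊗n}`. -/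
abbrev factorMap {n : ℕ} (i : Fin n) : R →ₐ[k] TensorPow k R n :=
  PiTensorProduct.singleAlgHom (A := fun _ => R) i

/-- The algebra homomorphism `R^{⊗m} → R^{⊗n}` induced by `f : Fin m → Fin n`: it carries the `j`-th
factor of `R^{⊗m}` to the `f j`-th factor of `R^{⊗n}`, factors with the same image being multiplied
together. -/
def tensorPowMap {m n : ℕ} (f : Fin m → Fin n) : TensorPow k R m →ₐ[k] TensorPow k R n :=
  PiTensorProduct.liftAlgHom
    ((MultilinearMap.mkPiAlgebra k (Fin m) (TensorPow k R n)).compLinearMap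
      fun j => (factorMap k R (f j)).toLinearMap)
    (by simp [-PiTensorProduct.singleAlgHom_apply])
    (fun x y => by simp [-PiTensorProduct.singleAlgHom_apply, Finset.prod_mul_distrib])

theorem tensorPowMap_tprod {m n : ℕ} (f : Fin m → Fin n) (x : Fin m → R) :
    tensorPowMap k R f (PiTensorProduct.tprod k x) = ∏ j, factorMap k R (f j) (x j) := by
  simp [tensorPowMap, PiTensorProduct.liftAlgHom]

theorem tensorPowMap_comp_factorMap {m n : ℕ} (f : Fin m → Fin n) (j : Fin m) :
    (tensorPowMap k R f).comp (factorMap k R j) = factorMap k R (f j) := by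
  ext a
  rw [AlgHom.comp_apply, PiTensorProduct.singleAlgHom_apply, tensorPowMap_tprod,
    Finset.prod_eq_single j]
  · simp [-PiTensorProduct.singleAlgHom_apply]
  · intro i _ hij
    simp only [MonoidHom.mulSingle_apply, Pi.mulSingle_eq_of_ne hij, map_one]
  · simp

theorem tensorPowMap_comp_of_leftInverse {m n : ℕ} {f : Fin m → Fin n} {g : Fin n → Fin m}
    (h : Function.LeftInverse g f) :
    (tensorPowMap k R g).comp (tensorPowMap k R f) = AlgHom.id k (TensorPow k R m) := by
  refine PiTensorProduct.algHom_ext fun j => ?_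
  rw [AlgHom.comp_assoc, tensorPowMap_comp_factorMap, tensorPowMap_comp_factorMap, h j,
    AlgHom.id_comp]

theorem diagMap_comp_factorMap {n : ℕ} (i : Fin n) :
    (diagMap k R n).comp (factorMap k R i) = AlgHom.id k R := by
  ext a
  simp [diagMap_tprod]

theorem diagMap_comp_tensorPowMap {m n : ℕ} (f : Fin m → Fin n) :
    (diagMap k R n).comp (tensorPowMap k R f) = diagMap k R m := by
  refine PiTensorProduct.algHom_ext fun j => ?_
  rw [AlgHom.comp_assoc, tensorPowMap_comp_factorMap, diagMap_comp_factorMap,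
    diagMap_comp_factorMap]

end TensorPow

/-! ### Transport of `p^{-e}`-linear maps along a split homomorphism -/

section Transport

variable {k : Type*} [Field k] {p : ℕ} [Fact p.Prime] [CharP k p]

/-- For a homomorphism `i : A → B` with left inverse `r : B → A`, the `p^{-e}`-linear map
`r ∘ ψ ∘ i^{1/q}` on `A` obtained from a `p^{-e}`-linear map `ψ` on `B`. -/
def CartierMap.retract {A B : Type*} [CommRing A] [Algebra k A] [CommRing B] [Algebra k B]
    {e : ℕ} (i : A →+* B) (r : B →+* A) (h : Function.LeftInverse r i) (ψ : CartierMap k p B e) :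
    CartierMap k p A e where
  toFun z := r (ψ (rootMap k p e i z))
  map_add' x y := by simp
  map_smul' a z := by
    have hz : rootMap k p e i (a • z) = i a • rootMap k p e i z := by
      obtain ⟨y, rfl⟩ := (root k p e).surjective z
      simp [smul_root, rootMap]
    rw [hz, map_smul, smul_eq_mul, map_mul, h a, RingHom.id_apply, smul_eq_mul]

end Transport

/-! ### Monotonicity of the diagonal Cartier algebras -/

section Diagonal

variable (k : Type*) [Field k] (p : ℕ) [Fact p.Prime] [CharP k p]
variable (R : Type*) [CommRing R] [Algebra k R]

theorem diagonalDegree_le {m n : ℕ} (hm : 1 ≤ m) (hmn : m ≤ n) (e : ℕ) :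
    diagonalDegree k p R n e ≤ diagonalDegree k p R m e := by
  rintro φ ⟨φ', hφ'⟩
  -- The inclusion of indices splits only because `Fin m` is nonempty.
  have : Nonempty (Fin m) := ⟨⟨0, hm⟩⟩
  have hgf := Function.leftInverse_invFun (Fin.castLE_injective hmn)
  set f := Fin.castLE hmn
  set g := Function.invFun f
  refine ⟨φ'.retract (tensorPowMap k R f : TensorPow k R m →+* TensorPow k R n)
    (tensorPowMap k R g : TensorPow k R n →+* TensorPow k R m)
    (DFunLike.congr_fun (tensorPowMap_comp_of_leftInverse k R hgf)), fun z => ?_⟩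
  have hz : rootMap k p e (diagMap k R m : TensorPow k R m →+* R) z =
      rootMap k p e (diagMap k R n : TensorPow k R n →+* R)
        (rootMap k p e (tensorPowMap k R f : TensorPow k R m →+* TensorPow k R n) z) := by
    rw [← diagMap_comp_tensorPowMap k R f]
    rfl
  rw [hz, hφ', ← diagMap_comp_tensorPowMap k R g]
  rfl

theorem diagonalCartierAlgebra_le {m n : ℕ} (hm : 1 ≤ m) (hmn : m ≤ n) :
    diagonalCartierAlgebra k p R n ≤ diagonalCartierAlgebra k p R m :=
  fun _ hx e => diagonalDegree_le k p R hm hmn e (hx e)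

variable {k p R} in
theorem IsDiagonallyFRegular.of_le {m n : ℕ} (hm : 1 ≤ m) (hmn : m ≤ n)
    (h : IsDiagonallyFRegular k p R n) : IsDiagonallyFRegular k p R m := by
  intro x hx
  obtain ⟨e, φ, hφ, hφx⟩ := h x hx
  exact ⟨e, φ, diagonalDegree_le k p R hm hmn e hφ, hφx⟩

end Diagonal

end DiagCartier

end

open DiagCartier in
/-- For the affine toric ring `R = k[σ^∨ ∩ ℤ^d]` of a rational polyhedral cone over a perfect field
of characteristic `p > 0`, `D^{(n+1)}(R) ⊆ D^{(n)}(R)` for all `n > 0`, and if `R` is `n`-diagonally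
`F`-regular then it is `m`-diagonally `F`-regular for all `1 ≤ m ≤ n`. -/
theorem mainTheorem8 (k : Type*) [Field k] (p : ℕ) [Fact p.Prime] [CharP k p] [PerfectField k]
    (d : ℕ) (σ : PointedCone ℝ (Fin d → ℝ)) (hσ : IsRationalCone σ) :
    (∀ n : ℕ, 0 < n →
      diagonalCartierAlgebra k p (ToricRing k σ) (n + 1) ≤
        diagonalCartierAlgebra k p (ToricRing k σ) n) ∧
    (∀ m n : ℕ, 1 ≤ m → m ≤ n →
      IsDiagonallyFRegular k p (ToricRing k σ) n →
        IsDiagonallyFRegular k p (ToricRing k σ) m) := by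
  exact ⟨fun n hn => diagonalCartierAlgebra_le k p _ hn n.le_succ,
    fun _ _ hm hmn h => h.of_le hm hmn⟩
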